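/- Let $G=(V,E)$ be a locally finite simple graph of bounded degree, i.e. $\sup_{x\in V} d(x)<\infty$, where $d(x)$ is the degree of $x$, and let $s\colon E\to\{-1,1\}$ be any function. The signed voter model is the Feller process on $\{-1,1\}^V$ whose generator acts on functions $f$ depending on finitely many coordinates by $$\Omega f(\eta)=\sum_{x\in V}\big(f(\eta^x)-f(\eta)\big)\,\frac{1}{d(x)}\sum_{y\colon \{x,y\}\in E}1\{\eta(x)\eta(y)\neq s(\{x,y\})\},$$ where $\eta^x$ is $\eta$ with the spin at $x$ reversed (a vertex without neighbours never flips). An equilibrium is a probability measure on $\{-1,1\}^V$ that is invariant under the transition semigroup of this process. An unsatisfied cycle is a closed nearest neighbour path (vertices may be repeated) along which the product of the signs $s$ of the edges crossed, counted with multiplicity, is $-1$. Let $(X(t))_{t\ge 0}$ be the continuous-time simple random walk on $G$, which waits an exponential time of mean one at each vertex and then jumps to a uniformly chosen neighbour (and stays where it is if there is none); $P^x$ is its law started at $x$. If the signed voter model has at least two distinct equilibria, then there are a set $W\subset V$ and a vertex $x\in V$ such that the subgraph of $G$ induced on $W$ contains no unsatisfied cycle and $$P^x\big(X(t)\in W\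 \text{for all } t\ge 0\big)>0.$$ -/

import Mathlib

open MeasureTheory ProbabilityTheory Filter Topology
open scoped NNReal ENNReal

namespace SignedVoter

/-- Configurations: an assignment of a spin in `{-1, 1}` (the units of `ℤ`) to each vertex. -/
abbrev Config (V : Type*) : Type _ := V → ℤˣ

section Spins

variable {V : Type*} (G : SimpleGraph V) [G.LocallyFinite] (s : G.edgeSet → ℤˣ)

/-- The configuration `η` with the spin at `x` reversed. -/
noncomputable def flip (x : V) (η : Config V) : Config V :=
  open Classical in Function.update η x (-η x)

/-- The flip rate at `x`: the proportion of neighbours `y` of `x` such that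
`η x * η y ≠ s {x, y}`. It is `0` at an isolated vertex. -/
noncomputable def flipRate (x : V) (η : Config V) : ℝ :=
  open Classical in
  (1 / (G.degree x : ℝ)) *
    ∑ y : G.neighborSet x, if η x * η y ≠ s ⟨s(x, (y : V)), y.2⟩ then 1 else 0

/-- `f` depends on the spins at finitely many vertices only. -/
def IsCylinder (f : Config V → ℝ) : Prop := ∃ F : Finset V, DependsOn f (F : Set V)

/-- The operator `Ω` of the signed voter model; for a cylinder function `f` the sum has finitely
many non-zero terms. -/
noncomputable def generator (f : Config V → ℝ) (η : Config V) : ℝ :=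
  ∑ᶠ x : V, (f (flip x η) - f η) * flipRate G s x η

/-- `P` is the transition semigroup of the signed voter model, that is, of the spin system
with operator `Ω`: a Feller Markov semigroup on the configuration space whose infinitesimal
generator (the derivative at time `0`, in the uniform norm) is `Ω` on cylinder functions. -/
structure IsTransitionSemigroup (P : ℝ≥0 → Kernel (Config V) (Config V)) : Prop where
  markov : ∀ t, IsMarkovKernel (P t)
  zero : P 0 = Kernel.id
  add : ∀ t u, P (t + u) = P u ∘ₖ P t
  feller : ∀ t (f : Config V → ℝ), Continuous f → Continuous fun η => ∫ ξ, f ξ ∂(P t η)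
  generator_eq : ∀ f : Config V → ℝ, IsCylinder f →
    TendstoUniformly (fun (t : ℝ≥0) η => ((∫ ξ, f ξ ∂(P t η)) - f η) / (t : ℝ))
      (generator G s f) (𝓝[>] 0)

/-- An equilibrium of the signed voter model: a probability measure on configurations that is
invariant under its transition semigroup. -/
def IsEquilibrium (μ : Measure (Config V)) : Prop :=
  IsProbabilityMeasure μ ∧
    ∃ P : ℝ≥0 → Kernel (Config V) (Config V), IsTransitionSemigroup G s P ∧
      ∀ t, (P t).Invariant μ

/-- The signed voter model has more than one equilibrium. -/
def HasMultipleEquilibria : Prop :=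
  ∃ μ ν : Measure (Config V), IsEquilibrium G s μ ∧ IsEquilibrium G s ν ∧ μ ≠ ν

end Spins

section Cycles

variable {V : Type*} {G : SimpleGraph V}

/-- The sign of a nearest neighbour path: the product of the signs of the edges it crosses,
counted with multiplicity. -/
def walkSign (s : G.edgeSet → ℤˣ) : {u v : V} → G.Walk u v → ℤˣ
  | _, _, .nil => 1
  | u, _, .cons (v := v) h p => s ⟨s(u, v), h⟩ * walkSign s p

/-- The graph induced on `W` has no unsatisfied cycle: no closed nearest neighbour path that
stays in `W` has sign `-1`. (Vertices may be repeated; a closed path of sign `-1` always contains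
a cycle without repetitions of sign `-1`.) -/
def HasNoUnsatisfiedCycle (s : G.edgeSet → ℤˣ) (W : Set V) : Prop :=
  ∀ (v : V) (w : G.Walk v v), (∀ u ∈ w.support, u ∈ W) → walkSign s w ≠ -1

end Cycles

section RandomWalk

variable {V : Type*} [MeasurableSpace V] [DiscreteMeasurableSpace V]
  (G : SimpleGraph V) [G.LocallyFinite]

/-- One jump of the walk from `x`: uniform on the neighbours of `x` (no move if there are none). -/
noncomputable def jumpPMF (x : V) : PMF V :=
  open Classical in
  if h : (G.neighborFinset x).Nonempty then PMF.uniformOfFinset (G.neighborFinset x) h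
  else PMF.pure x

/-- The transition kernel of the embedded discrete-time chain. -/
noncomputable def jumpKernel : Kernel V V where
  toFun x := (jumpPMF G x).toMeasure
  measurable' := Measurable.of_discrete

instance : IsMarkovKernel (jumpKernel G) :=
  ⟨fun x => PMF.toMeasure.isProbabilityMeasure (jumpPMF G x)⟩

/-- The same kernel, as a function of the history up to time `n`. -/
noncomputable def historyKernel (n : ℕ) : Kernel (Finset.Iic n → V) V :=
  (jumpKernel G).comap (fun h => h ⟨n, Finset.mem_Iic.2 le_rfl⟩) (measurable_pi_apply _)

instance (n : ℕ) : IsMarkovKernel (historyKernel G n) := by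
  unfold historyKernel; infer_instance

/-- The law, on sequences of vertices, of the embedded chain started at `x`. -/
noncomputable def chainLaw (x : V) : Measure (ℕ → V) :=
  Kernel.traj (X := fun _ : ℕ => V) (fun n => historyKernel G n) 0 (fun _ => x)

/-- The law of the continuous-time walk started at `x`, realised on pairs consisting of the
sequence of visited vertices and an independent i.i.d. sequence of mean-one exponential holding
times. -/
noncomputable def walkLaw (x : V) : Measure ((ℕ → V) × (ℕ → ℝ)) :=
  (chainLaw G x).prod (Measure.infinitePi fun _ : ℕ => expMeasure 1)

/-- The position at time `t` of the continuous-time random walk: the `n`-th vertex, where `n` is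
the least number such that the first `n + 1` holding times add up to more than `t`. -/
noncomputable def position (ω : (ℕ → V) × (ℕ → ℝ)) (t : ℝ≥0) : V :=
  ω.1 (sInf {n : ℕ | (t : ℝ) < ∑ i ∈ Finset.range (n + 1), ω.2 i})

end RandomWalk

end SignedVoter

/-! The proof uses duality. The generator applied to a product of spins over a finite set $A$ is
that of random walks started from $A$, which annihilate in pairs when they meet and pick up the
signs of the edges crossed. The moments of an equilibrium are therefore harmonic for this set-valued
motion, and since spin products determine a measure, two distinct equilibria give a nonzero bounded
harmonic function $w$, the difference of their moments, with $w(\emptyset)=0$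
(`exists_signed_harmonic` takes it from there).

Take $A$ of least size with $w(A)\ne 0$. A collision leads to a smaller set, where $w=0$. So $w$,
read as a function $U$ on $V^A$ that is zero at coinciding particles, is fixed off its zero set by
the operator $T$ that moves one uniformly chosen particle, with no interaction. Since $T$ is
dominated by a Markov operator, $T^mU$ stays within $\sup|U|-|U|$ of $U$, and Cesàro limits give a
nonzero bounded function with $Th=h$. As $T$ is a mean of commuting contractions, $h$ is invariant
under the motion of each particle (`eq_of_sum_eq_card_smul`). Freezing all particles but one yields
a nonzero bounded $h$ on $V$ that is harmonic for a single signed walk.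

Let $c=\sup|h|$, let $M$ bound the degrees and let $W=\{|h|>c-c/M\}$. Near its maximum $|h|$ leaves
no room for a neighbour contributing with the wrong sign, so the sign of $h$ is a gauge in which
every edge inside $W$ is satisfied. Also $|h|$ is subharmonic, so $c-|h|$ is a nonnegative
superharmonic function, and it bounds the probability of leaving $W$ away from one. -/

namespace SignedVoter

/-! ### Contractions of the uniform norm and their fixed points -/

section Contractions

variable {X : Type*}

/-- An operator on functions that does not increase the uniform norm. -/
def IsContraction (T : (X → ℝ) →L[ℝ] (X → ℝ)) : Prop :=
  ∀ (f : X → ℝ) (c : ℝ), (∀ x, |f x| ≤ c) → ∀ x, |T f x| ≤ c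

lemma IsContraction.pow {T : (X → ℝ) →L[ℝ] (X → ℝ)} (hT : IsContraction T) (m : ℕ) :
    IsContraction (T ^ m) := by
  intro f c hf
  induction m with
  | zero => simpa using hf
  | succ m ih =>
    intro x
    rw [pow_succ']
    exact hT _ _ ih x

lemma IsContraction.of_dominated {T P : (X → ℝ) →L[ℝ] (X → ℝ)} (hmono : Monotone P)
    (hconst : ∀ c : ℝ, P (fun _ => c) = fun _ => c)
    (hTP : ∀ f x, |T f x| ≤ P (fun z => |f z|) x) : IsContraction T := by
  intro f c hf x
  have := hmono (show (fun z => |f z|) ≤ fun _ => c from hf) x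
  rw [hconst] at this
  exact (hTP f x).trans this

/-- If `U` is fixed by `T` off its zero set, and `T` is dominated by a Markov operator, then the
powers of `T` move `U` little at the points where `|U|` is nearly maximal. -/
lemma abs_pow_sub_le_of_dominated {T P : (X → ℝ) →L[ℝ] (X → ℝ)} (hmono : Monotone P)
    (hconst : ∀ c : ℝ, P (fun _ => c) = fun _ => c)
    (hTP : ∀ f x, |T f x| ≤ P (fun z => |f z|) x) {U : X → ℝ} {c : ℝ} (hU : ∀ x, |U x| ≤ c)
    (hfix : ∀ x, T U x = U x ∨ U x = 0) (m : ℕ) (x : X) :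
    |(T ^ m) U x - U x| ≤ c - |U x| := by
  induction m generalizing x with
  | zero => simpa using hU x
  | succ m ih =>
    have h1 : (T ^ (m + 1)) U x - U x = T ((T ^ m) U - U) x + (T U x - U x) := by
      rw [map_sub, pow_succ']; simp
    have h2 : |T ((T ^ m) U - U) x| ≤ c - P (fun z => |U z|) x := by
      refine (hTP _ x).trans ((hmono (fun z => ?_) x).trans_eq
        (b := P ((fun _ => c) - fun z => |U z|) x) ?_)
      · exact ih z
      · rw [map_sub, hconst]; rfl
    have h3 := hTP U x
    rw [h1]
    refine (abs_add_le _ _).trans ?_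
    rcases hfix x with h | h
    -- If $TU=U$ at $x$, domination gives $|U|\le P|U|$ there. In the other case $U=0$ at $x$, and
    -- $|TU|\le P|U|$ cancels the $-P|U|$ in `h2`.
    · rw [h] at h3 ⊢
      simp only [sub_self, abs_zero, add_zero]
      linarith
    · rw [h, sub_zero, abs_zero, sub_zero]
      linarith

/-- If `T U` stays close to `U` along all powers of a contraction `T`, then a limit of Cesàro
averages is a fixed point of `T` close to `U`. -/
lemma exists_fixed_point_near {T : (X → ℝ) →L[ℝ] (X → ℝ)} (hT : IsContraction T)
    {U r : X → ℝ} {c : ℝ} (hU : ∀ x, |U x| ≤ c)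
    (hr : ∀ (m : ℕ) x, |(T ^ m) U x - U x| ≤ r x) :
    ∃ h : X → ℝ, (∀ x, |h x| ≤ c) ∧ (∀ x, |h x - U x| ≤ r x) ∧ T h = h := by
  let A : ℕ → X → ℝ := fun N => ((N : ℝ) + 1)⁻¹ • ∑ m ∈ Finset.range (N + 1), (T ^ m) U
  have hA : ∀ N x, A N x = ((N : ℝ) + 1)⁻¹ * ∑ m ∈ Finset.range (N + 1), (T ^ m) U x := by
    intro N x; simp [A]
  have avg : ∀ (N : ℕ) (f : ℕ → ℝ) (b : ℝ), (∀ m, |f m| ≤ b) →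
      |((N : ℝ) + 1)⁻¹ * ∑ m ∈ Finset.range (N + 1), f m| ≤ b := by
    intro N f b hf
    rw [abs_mul, abs_of_nonneg (by positivity), inv_mul_le_iff₀ (by positivity)]
    refine (Finset.abs_sum_le_sum_abs _ _).trans ((Finset.sum_le_sum fun m _ => hf m).trans ?_)
    simp
  have hAc : ∀ N x, |A N x| ≤ c := fun N x => by
    rw [hA]; exact avg N _ c fun m => hT.pow m U c hU x
  have hAr : ∀ N x, |A N x - U x| ≤ r x := fun N x => by
    have : A N x - U x =
        ((N : ℝ) + 1)⁻¹ * ∑ m ∈ Finset.range (N + 1), ((T ^ m) U x - U x) := by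
      rw [hA, Finset.sum_sub_distrib]
      simp only [Finset.sum_const, Finset.card_range, nsmul_eq_mul]
      push_cast
      field_simp
    rw [this]
    exact avg N _ _ fun m => hr m x
  have hcomp : IsCompact (Set.univ.pi fun _ : X => Set.Icc (-c) c) :=
    isCompact_univ_pi fun _ => isCompact_Icc
  -- The limit is pointwise and along an ultrafilter, since $X$ may be uncountable and subsequences
  -- need not converge; $T$ is continuous for this product topology.
  obtain ⟨h, -, hh⟩ := hcomp.ultrafilter_le_nhds (Ultrafilter.map A (hyperfilter ℕ)) (by
    simp only [Ultrafilter.coe_map, le_principal_iff, mem_map]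
    exact univ_mem' fun N => by
      simp only [Set.mem_preimage, Set.mem_pi, Set.mem_univ, forall_const, Set.mem_Icc]
      exact fun x => abs_le.1 (hAc N x))
  have hlim : Tendsto A (hyperfilter ℕ) (𝓝 h) := hh
  have hlimx : ∀ x, Tendsto (fun N => A N x) (hyperfilter ℕ) (𝓝 (h x)) :=
    fun x => (tendsto_pi_nhds.1 hlim) x
  refine ⟨h, fun x => ?_, fun x => ?_, ?_⟩
  · exact le_of_tendsto (hlimx x).abs (Eventually.of_forall fun N => hAc N x)
  · exact le_of_tendsto ((hlimx x).sub_const _).abs (Eventually.of_forall fun N => hAr N x)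
  · funext x
    have h1 : Tendsto (fun N => T (A N) x) (hyperfilter ℕ) (𝓝 (T h x)) :=
      (tendsto_pi_nhds.1 ((T.continuous.tendsto h).comp hlim)) x
    have h2 := h1.sub (hlimx x)
    have h3 : ∀ N, T (A N) x - A N x = ((N : ℝ) + 1)⁻¹ * ((T ^ (N + 1)) U x - U x) := by
      intro N
      have : T (A N) x = ((N : ℝ) + 1)⁻¹ * ∑ m ∈ Finset.range (N + 1), (T ^ (m + 1)) U x := by
        simp [A, map_sum, pow_succ']
      rw [this, hA, ← mul_sub, ← Finset.sum_sub_distrib,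
        Finset.sum_range_sub (fun m => (T ^ m) U x)]
      simp
    have h4 : Tendsto (fun N : ℕ => ((N : ℝ) + 1)⁻¹ * r x) atTop (𝓝 0) := by
      have := (tendsto_one_div_add_atTop_nhds_zero_nat (𝕜 := ℝ)).mul_const (r x)
      simpa using this
    have h5 : Tendsto (fun N => T (A N) x - A N x) (hyperfilter ℕ) (𝓝 0) := by
      refine squeeze_zero_norm (fun N => ?_) (h4.mono_left Nat.hyperfilter_le_atTop)
      rw [h3, Real.norm_eq_abs, abs_mul, abs_of_nonneg (by positivity)]
      exact mul_le_mul_of_nonneg_left (hr _ _) (by positivity)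
    linarith [tendsto_nhds_unique h2 h5]

/-- A bounded function invariant under the mean of finitely many commuting contractions is
invariant under each of them. -/
lemma eq_of_sum_eq_card_smul {ι : Type*} [Fintype ι] {K : ι → (X → ℝ) →L[ℝ] (X → ℝ)}
    (hK : ∀ i, IsContraction (K i)) (hcomm : ∀ i j, Commute (K i) (K j))
    {h : X → ℝ} {c : ℝ} (hc : ∀ x, |h x| ≤ c)
    (hh : ∑ j, K j h = (Fintype.card ι : ℝ) • h) (i : ι) : K i h = h := by
  classical
  set n : ℝ := (Fintype.card ι : ℝ) with hn
  have hn1 : 1 ≤ n := Nat.one_le_cast.2 (Fintype.card_pos_iff.2 ⟨i⟩)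
  set d : X → ℝ := K i h - h with hd
  have hdsum : ∑ j, K j d = n • d := by
    have : ∀ j, K j d = K i (K j h) - K j h := fun j => by
      have := congrArg (fun T : (X → ℝ) →L[ℝ] (X → ℝ) => T h) (hcomm j i).eq
      simp only [mul_apply_eq_comp] at this
      rw [hd, map_sub, this]
    rw [Finset.sum_congr rfl fun j _ => this j, Finset.sum_sub_distrib, ← map_sum, hh, map_smul,
      smul_sub]
  have hdb : ∀ x, |d x| ≤ 2 * c := fun x => by
    have h1 := abs_le.1 (hK i h c hc x)
    have h2 := abs_le.1 (hc x)
    rw [abs_le]; simp only [hd, Pi.sub_apply]; constructor <;> linarith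
  by_contra hne
  obtain ⟨x₀, hx₀⟩ : ∃ x, d x ≠ 0 := by
    by_contra! hall
    exact hne (sub_eq_zero.1 (funext hall))
  have : Nonempty X := ⟨x₀⟩
  have hbdd : BddAbove (Set.range fun x => |d x|) := ⟨2 * c, by rintro _ ⟨x, rfl⟩; exact hdb x⟩
  set D : ℝ := ⨆ x, |d x| with hD
  have hdD : ∀ x, |d x| ≤ D := fun x => le_ciSup hbdd x
  have hDpos : 0 < D := (abs_pos.2 hx₀).trans_le (hdD x₀)
  -- The deficit from the supremum $D$ grows by a factor of at most $n$ with each application of `K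
  -- i`: in the mean of the $n$ terms, each of the others is at most $D$.
  have key : ∀ (t : ℝ), |t| = 1 → ∀ x (m : ℕ),
      D - n ^ m * (D - t * d x) ≤ t * (K i ^ m) d x := by
    intro t ht x m
    induction m with
    | zero => simp
    | succ m ih =>
      have h1 : ∑ j, (K i ^ m) (K j d) x = n * (K i ^ m) d x := by
        have := congrFun (congrArg (K i ^ m) hdsum) x
        simpa [map_sum] using this
      have h2 : ∀ j, t * (K i ^ m) (K j d) x ≤ D := fun j => by
        refine (le_abs_self _).trans ?_
        rw [abs_mul, ht, one_mul]
        exact (hK i).pow m _ _ (hK j _ _ hdD) x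
      have h3 : t * (n * (K i ^ m) d x) ≤ t * (K i ^ m) (K i d) x + (n - 1) * D := by
        rw [← h1, Finset.mul_sum, ← Finset.add_sum_erase _ _ (Finset.mem_univ i)]
        refine add_le_add le_rfl ((Finset.sum_le_sum fun j _ => h2 j).trans ?_)
        rw [Finset.sum_const, Finset.card_erase_of_mem (Finset.mem_univ i), Finset.card_univ,
          nsmul_eq_mul, Nat.cast_sub (Fintype.card_pos_iff.2 ⟨i⟩), Nat.cast_one]
      have h4 : (K i ^ (m + 1)) d x = (K i ^ m) (K i d) x := by rw [pow_succ]; rfl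
      rw [h4, pow_succ]
      nlinarith [mul_le_mul_of_nonneg_left ih (by linarith : (0 : ℝ) ≤ n)]
  -- With $mD/2>2c$, a contradiction follows once the first $m$ iterates of $d$ are at least $D/2$
  -- in the direction $t$ at one point, because their sum telescopes to $K_i^mh-h$.
  obtain ⟨m, hm⟩ := exists_nat_gt (4 * c / D)
  rw [div_lt_iff₀ hDpos] at hm
  have hnm : 0 < n ^ m := by positivity
  obtain ⟨x, hx⟩ := exists_lt_of_lt_ciSup (show D - D / (2 * n ^ m) < ⨆ x, |d x| by
    rw [← hD]; have : 0 < D / (2 * n ^ m) := by positivity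
    linarith)
  obtain ⟨t, ht, htd⟩ : ∃ t : ℝ, |t| = 1 ∧ t * d x = |d x| := by
    rcases abs_cases (d x) with ⟨h1, -⟩ | ⟨h1, -⟩
    · exact ⟨1, by simp, by rw [h1, one_mul]⟩
    · exact ⟨-1, by simp, by rw [h1]; ring⟩
  have hgap : n ^ m * (D - t * d x) ≤ D / 2 := by
    have : D - t * d x ≤ D / (2 * n ^ m) := by linarith
    calc n ^ m * (D - t * d x) ≤ n ^ m * (D / (2 * n ^ m)) := by gcongr
      _ = D / 2 := by field_simp
  have hterm : ∀ j ∈ Finset.range m, D / 2 ≤ t * (K i ^ j) d x := fun j hj => by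
    have h1 := key t ht x j
    have h2 : n ^ j ≤ n ^ m := pow_le_pow_right₀ hn1 (Finset.mem_range.1 hj).le
    have h3 : 0 ≤ D - t * d x := by rw [htd]; linarith [hdD x]
    nlinarith [mul_le_mul_of_nonneg_right h2 h3]
  have hsum : ∑ j ∈ Finset.range m, t * (K i ^ j) d x = t * ((K i ^ m) h x - h x) := by
    rw [← Finset.mul_sum]
    have : ∀ j, (K i ^ j) d x = (K i ^ (j + 1)) h x - (K i ^ j) h x := fun j => by
      rw [hd, map_sub, pow_succ]; rfl
    rw [Finset.sum_congr rfl fun j _ => this j, Finset.sum_range_sub (fun j => (K i ^ j) h x)]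
    simp
  have hlow : (m : ℝ) * (D / 2) ≤ t * ((K i ^ m) h x - h x) := by
    rw [← hsum]
    simpa using Finset.card_nsmul_le_sum _ _ _ hterm
  have hup : t * ((K i ^ m) h x - h x) ≤ 2 * c := by
    refine (le_abs_self _).trans ?_
    rw [abs_mul, ht, one_mul]
    have h1 := abs_le.1 ((hK i).pow m h c hc x)
    have h2 := abs_le.1 (hc x)
    rw [abs_le]; constructor <;> linarith
  linarith

end Contractions

/-! ### Spin products and the measures they determine -/

section SpinProducts

variable {V : Type*}

/-- The product of the spins over a finite set of vertices. -/
noncomputable def spinProd (A : Finset V) (η : Config V) : ℝ := ∏ x ∈ A, ((η x : ℤ) : ℝ)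

lemma measurable_spin (x : V) : Measurable fun η : Config V => ((η x : ℤ) : ℝ) :=
  (Measurable.of_discrete (f := fun k : ℤ => (k : ℝ))).comp
    ((comap_measurable (Units.val : ℤˣ → ℤ)).comp (measurable_pi_apply x))

lemma measurable_spinProd (A : Finset V) : Measurable (spinProd A) :=
  Finset.measurable_prod A fun x _ => measurable_spin x

lemma abs_unit_cast (u : ℤˣ) : |((u : ℤ) : ℝ)| = 1 := by
  rcases Int.units_eq_one_or u with rfl | rfl <;> simp

lemma unit_cast_mul_self (u : ℤˣ) : ((u : ℤ) : ℝ) * ((u : ℤ) : ℝ) = 1 := by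
  rcases Int.units_eq_one_or u with rfl | rfl <;> simp

lemma abs_spinProd (A : Finset V) (η : Config V) : |spinProd A η| = 1 := by
  rw [spinProd, Finset.abs_prod]
  exact Finset.prod_eq_one fun x _ => abs_unit_cast _

lemma integrable_spinProd (A : Finset V) (μ : Measure (Config V)) [IsFiniteMeasure μ] :
    Integrable (spinProd A) μ :=
  .of_bound (measurable_spinProd A).aestronglyMeasurable 1
    (ae_of_all _ fun η => (abs_spinProd A η).le)

lemma spinProd_symmDiff_singleton [DecidableEq V] (A : Finset V) (x : V) (η : Config V) :
    spinProd (symmDiff A {x}) η = spinProd A η * ((η x : ℤ) : ℝ) := by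
  by_cases hx : x ∈ A
  · have h : symmDiff A {x} = A.erase x := by
      ext y; simp only [Finset.mem_symmDiff, Finset.mem_singleton, Finset.mem_erase]
      constructor
      · rintro (h | h)
        · exact ⟨h.2, h.1⟩
        · exact absurd (h.1 ▸ hx) h.2
      · exact fun h => .inl ⟨h.2, h.1⟩
    rw [h, spinProd, spinProd, ← Finset.prod_erase_mul _ _ hx, mul_assoc, unit_cast_mul_self,
      mul_one]
  · have h : symmDiff A {x} = insert x A := by
      ext y; simp only [Finset.mem_symmDiff, Finset.mem_singleton, Finset.mem_insert]
      constructor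
      · rintro (h | h)
        · exact .inr h.1
        · exact .inl h.1
      · rintro (rfl | h)
        · exact .inr ⟨rfl, hx⟩
        · exact .inl ⟨h, fun e => hx (e ▸ h)⟩
    rw [h, spinProd, spinProd, Finset.prod_insert hx, mul_comm]

lemma isCylinder_spinProd (A : Finset V) : IsCylinder (spinProd A) :=
  ⟨A, fun _ _ h => Finset.prod_congr rfl fun x hx => by rw [h x hx]⟩

/-- The spin products determine a probability measure on configurations. -/
lemma ext_of_integral_spinProd {μ ν : Measure (Config V)} [IsProbabilityMeasure μ]
    [IsProbabilityMeasure ν] (h : ∀ A : Finset V, ∫ η, spinProd A η ∂μ = ∫ η, spinProd A η ∂ν) :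
    μ = ν := by
  classical
  have hsing : ∀ (F : Finset V) (ξ : F → ℤˣ), MeasurableSet {η : Config V | F.restrict η = ξ} := by
    intro F ξ
    have : {η : Config V | F.restrict η = ξ} =
        ⋂ x : F, (fun η : Config V => ((η x : ℤ) : ℝ)) ⁻¹' {((ξ x : ℤ) : ℝ)} := by
      ext η
      simp [funext_iff, Units.ext_iff]
    rw [this]
    exact MeasurableSet.iInter fun x => measurable_spin _ (measurableSet_singleton _)
  -- Expansion of $\prod_{x\in F}(1+\xi_x\eta_x)/2$. The default `0` is never used, as $A\subseteq
  -- F$.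
  have hind : ∀ (F : Finset V) (ξ : F → ℤˣ) (η : Config V),
      {η : Config V | F.restrict η = ξ}.indicator (fun _ => (1 : ℝ)) η =
        (2⁻¹ : ℝ) ^ F.card * ∑ A ∈ F.powerset,
          (∏ x ∈ A, if hx : x ∈ F then ((ξ ⟨x, hx⟩ : ℤ) : ℝ) else 0) * spinProd A η := by
    intro F ξ η
    simp only [spinProd, ← Finset.prod_mul_distrib]
    rw [← Finset.prod_one_add, ← Finset.prod_const, ← Finset.prod_mul_distrib]
    by_cases hη : F.restrict η = ξ
    · rw [Set.indicator_of_mem (by exact hη)]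
      refine (Finset.prod_eq_one fun x hx => ?_).symm
      rw [dif_pos hx, ← hη]
      simp only [Finset.restrict, unit_cast_mul_self]
      norm_num
    · rw [Set.indicator_of_notMem (by exact hη)]
      obtain ⟨x, hx⟩ := Function.ne_iff.1 hη
      refine (Finset.prod_eq_zero x.2 ?_).symm
      rw [dif_pos x.2]
      have hx' : η x ≠ ξ x := hx
      rcases Int.units_eq_one_or (η x) with h1 | h1 <;>
        rcases Int.units_eq_one_or (ξ x) with h2 | h2 <;> simp_all
  have hfin : ∀ (F : Finset V), μ.map F.restrict = ν.map F.restrict := by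
    intro F
    have hm : ∀ (ρ : Measure (Config V)) [IsProbabilityMeasure ρ] (ξ : F → ℤˣ),
        ρ.real {η : Config V | F.restrict η = ξ} = (2⁻¹ : ℝ) ^ F.card * ∑ A ∈ F.powerset,
          (∏ x ∈ A, if hx : x ∈ F then ((ξ ⟨x, hx⟩ : ℤ) : ℝ) else 0) * ∫ η, spinProd A η ∂ρ := by
      intro ρ _ ξ
      rw [← integral_indicator_one (hsing F ξ)]
      simp_rw [← integral_const_mul]
      rw [← integral_finsetSum _ fun A _ => (integrable_spinProd A ρ).const_mul _,
        ← integral_const_mul]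
      exact integral_congr_ae (ae_of_all _ fun η => hind F ξ η)
    have hmeas : Measurable (F.restrict : Config V → F → ℤˣ) :=
      measurable_pi_lambda _ fun x => measurable_pi_apply _
    have hpre : ∀ (S : Set (F → ℤˣ)),
        F.restrict ⁻¹' S = ⋃ ξ ∈ S, {η : Config V | F.restrict η = ξ} := by
      intro S; ext η; simp
    ext S hS
    rw [Measure.map_apply hmeas hS, Measure.map_apply hmeas hS, hpre]
    have hd : S.PairwiseDisjoint fun ξ => {η : Config V | F.restrict η = ξ} := by
      intro ξ _ ξ' _ hne
      exact Set.disjoint_left.2 fun η h1 h2 => hne (h1.symm.trans h2)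
    rw [measure_biUnion S.to_countable hd fun ξ _ => hsing F ξ,
      measure_biUnion S.to_countable hd fun ξ _ => hsing F ξ]
    refine tsum_congr fun ξ => ?_
    rw [← measureReal_eq_measureReal_iff, hm μ, hm ν]
    simp only [h]
  have : ∀ F : Finset V, IsFiniteMeasure (μ.map F.restrict) := fun F => inferInstance
  exact IsProjectiveLimit.unique (P := fun F : Finset V => μ.map F.restrict)
    (fun F => rfl) fun F => (hfin F).symm

end SpinProducts

/-! ### Duality with signed annihilating walks -/

section Equilibria

variable {V : Type*} (G : SimpleGraph V) (s : G.edgeSet → ℤˣ)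

/-- The sign of the edge `{x, y}` as a real number, `0` if `x` and `y` are not adjacent. -/
noncomputable def edgeSign (x y : V) : ℝ :=
  open Classical in if h : G.Adj x y then ((s ⟨s(x, y), h⟩ : ℤ) : ℝ) else 0

lemma abs_edgeSign {x y : V} (h : G.Adj x y) : |edgeSign G s x y| = 1 := by
  rw [edgeSign, dif_pos h, abs_unit_cast]

variable [G.LocallyFinite]

/-- For signs, $-2\cdot 1\{u\ne s\}=su-1$; the factor $-2$ is the one by which flipping a spin of
$A$ changes the spin product. -/
lemma neg_two_mul_flipRate (x : V) (η : Config V) :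
    -2 * flipRate G s x η = (G.degree x : ℝ)⁻¹ * ∑ y ∈ G.neighborFinset x,
      (edgeSign G s x y * (((η x : ℤ) : ℝ) * ((η y : ℤ) : ℝ)) - 1) := by
  classical
  rw [flipRate, Finset.sum_subtype (p := (· ∈ G.neighborSet x)) (G.neighborFinset x) (by simp),
    one_div, mul_left_comm, Finset.mul_sum]
  congr 1
  refine Finset.sum_congr rfl fun y _ => ?_
  have hy : G.Adj x y := y.2
  rw [edgeSign, dif_pos hy]
  rcases Int.units_eq_one_or (η x) with h1 | h1 <;>
    rcases Int.units_eq_one_or (η y) with h2 | h2 <;>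
    rcases Int.units_eq_one_or (s ⟨s(x, (y : V)), hy⟩) with h3 | h3 <;>
    simp [h1, h2, h3] <;> norm_num

lemma spinProd_flip_sub (A : Finset V) (x : V) (η : Config V) :
    spinProd A (flip x η) - spinProd A η =
      open Classical in if x ∈ A then -2 * spinProd A η else 0 := by
  classical
  split_ifs with hx
  · have : spinProd A (flip x η) = -spinProd A η := by
      rw [spinProd, spinProd, ← Finset.mul_prod_erase _ _ hx, ← Finset.mul_prod_erase _ _ hx,
        ← neg_mul]
      congr 1
      · simp [flip]
      · refine Finset.prod_congr rfl fun y hy => ?_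
        simp [flip, Finset.ne_of_mem_erase hy]
    rw [this]; ring
  · rw [sub_eq_zero]
    refine Finset.prod_congr rfl fun y hy => ?_
    have : y ≠ x := fun h => hx (h ▸ hy)
    simp [flip, this]

open Classical in
/-- The generator acts on spin products as that of signed annihilating random walks. -/
lemma generator_spinProd (A : Finset V) (η : Config V) :
    generator G s (spinProd A) η = ∑ x ∈ A, (G.degree x : ℝ)⁻¹ * ∑ y ∈ G.neighborFinset x,
      (edgeSign G s x y * spinProd (symmDiff (symmDiff A {x}) {y}) η - spinProd A η) := by
  rw [generator, finsum_eq_sum_of_support_subset (s := A)]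
  · refine Finset.sum_congr rfl fun x hx => ?_
    rw [spinProd_flip_sub, if_pos hx, mul_right_comm, neg_two_mul_flipRate, mul_assoc,
      Finset.sum_mul]
    congr 1
    refine Finset.sum_congr rfl fun y _ => ?_
    rw [spinProd_symmDiff_singleton, spinProd_symmDiff_singleton]
    ring
  · intro x hx
    by_contra hxA
    exact hx (by dsimp only; rw [spinProd_flip_sub, if_neg (by simpa using hxA), zero_mul])

variable {G s}

/-- The difference quotients of the semigroup have mean zero by invariance and converge uniformly to
the generator. Only the semigroup attached to `μ` enters, so uniqueness of the semigroup is not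
needed. -/
lemma IsEquilibrium.integral_generator_spinProd {μ : Measure (Config V)}
    (hμ : IsEquilibrium G s μ) (A : Finset V) :
    ∫ η, generator G s (spinProd A) η ∂μ = 0 := by
  classical
  obtain ⟨hprob, P, hP, hinv⟩ := hμ
  have := hP.markov
  set f := spinProd A with hf
  have hmean : ∀ t, ∫ η, ((∫ ξ, f ξ ∂(P t η)) - f η) / (t : ℝ) ∂μ = 0 ∧
      Integrable (fun η => ((∫ ξ, f ξ ∂(P t η)) - f η) / (t : ℝ)) μ := by
    intro t
    have hb : (P t ∘ₖ Kernel.const Unit μ) () = μ := by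
      rw [← Measure.comp_eq_comp_const_apply]; exact hinv t
    have hi : Integrable f ((P t ∘ₖ Kernel.const Unit μ) ()) := by
      rw [hb]; exact integrable_spinProd A μ
    have hi' : Integrable (fun η => ∫ ξ, f ξ ∂(P t η)) μ := by
      have := hi.integral_comp
      rwa [Kernel.const_apply] at this
    have he : ∫ η, ∫ ξ, f ξ ∂(P t η) ∂μ = ∫ η, f η ∂μ := by
      have := Kernel.integral_comp hi
      rw [hb, Kernel.const_apply] at this
      exact this.symm
    refine ⟨?_, (hi'.sub (integrable_spinProd A μ)).div_const _⟩
    rw [integral_div, integral_sub hi' (integrable_spinProd A μ), he, sub_self, zero_div]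
  have hgi : Integrable (generator G s f) μ := by
    have : generator G s f = fun η => _ := funext fun η => generator_spinProd G s A η
    rw [this]
    refine integrable_finsetSum _ fun x _ => (integrable_finsetSum _ fun y _ => ?_).const_mul _
    exact ((integrable_spinProd _ μ).const_mul _).sub (integrable_spinProd A μ)
  have hlim := Metric.tendstoUniformly_iff.1 (hP.generator_eq f (isCylinder_spinProd A))
  by_contra hne
  obtain ⟨t, ht⟩ := (hlim _ (half_pos (abs_pos.2 hne))).exists
  have h1 : ∫ η, generator G s f η ∂μ =
      ∫ η, (generator G s f η - ((∫ ξ, f ξ ∂(P t η)) - f η) / (t : ℝ)) ∂μ := by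
    rw [integral_sub hgi (hmean t).2, (hmean t).1, sub_zero]
  have h2 := norm_integral_le_of_norm_le_const (μ := μ)
    (f := fun η => generator G s f η - ((∫ ξ, f ξ ∂(P t η)) - f η) / (t : ℝ))
    (ae_of_all _ fun η => (ht η).le)
  rw [probReal_univ, mul_one, ← h1, Real.norm_eq_abs] at h2
  linarith [abs_pos.2 hne]

open Classical in
/-- The moments of an equilibrium are harmonic for the signed annihilating random walks. -/
lemma IsEquilibrium.sum_integral_spinProd {μ : Measure (Config V)} (hμ : IsEquilibrium G s μ)
    (A : Finset V) :
    ∑ x ∈ A, (G.degree x : ℝ)⁻¹ * ∑ y ∈ G.neighborFinset x,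
      (edgeSign G s x y * ∫ η, spinProd (symmDiff (symmDiff A {x}) {y}) η ∂μ -
        ∫ η, spinProd A η ∂μ) = 0 := by
  have := hμ.1
  have hi : ∀ B, Integrable (spinProd B) μ := fun B => integrable_spinProd B μ
  rw [← hμ.integral_generator_spinProd A]
  simp_rw [generator_spinProd]
  rw [integral_finsetSum]
  · refine Finset.sum_congr rfl fun x _ => ?_
    rw [integral_const_mul, integral_finsetSum]
    · congr 1
      refine Finset.sum_congr rfl fun y _ => ?_
      rw [integral_sub ((hi _).const_mul _) (hi _), integral_const_mul]
    · exact fun y _ => ((hi _).const_mul _).sub (hi _)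
  · exact fun x _ =>
      (integrable_finsetSum _ fun y _ => ((hi _).const_mul _).sub (hi _)).const_mul _

end Equilibria

/-! ### Superharmonic functions and the probability of staying in a set -/

section ChainEscape

variable {V : Type*} [MeasurableSpace V] [DiscreteMeasurableSpace V]
  (G : SimpleGraph V) [G.LocallyFinite]

instance (x : V) : IsProbabilityMeasure (chainLaw G x) := by
  unfold chainLaw; infer_instance

variable {G}

lemma measurable_ite_forall_mem {ι : Type*} [Countable ι] {α : Type*} [MeasurableSpace α]
    (W : Set V) {p : α → ι → V} [∀ a, Decidable (∀ i, p a i ∈ W)] (hp : ∀ i, Measurable fun a => p a i) {φ : V → ℝ≥0∞}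
    {q : α → V} (hq : Measurable q) :
    Measurable fun a => if ∀ i, p a i ∈ W then φ (q a) else 1 := by
  refine Measurable.ite ?_ ((Measurable.of_discrete (f := φ)).comp hq) measurable_const
  have : {a | ∀ i, p a i ∈ W} = ⋂ i, (fun a => p a i) ⁻¹' W := by ext; simp
  rw [this]
  exact MeasurableSet.iInter fun i => hp i (.of_discrete)

open Classical in
/-- The expectation of a superharmonic function along the chain stopped on leaving `W`. -/
lemma lintegral_stopped_le {W : Set V} {φ : V → ℝ≥0∞}
    (hφ : ∀ x, ∫⁻ y, φ y ∂(jumpKernel G x) ≤ φ x) (hW : ∀ x, x ∉ W → 1 ≤ φ x) (x : V) (n : ℕ) :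
    ∫⁻ ω, (if ∀ k : Finset.Iic n, ω k ∈ W then φ (ω n) else 1) ∂(chainLaw G x) ≤ φ x := by
  have hmeas : ∀ n : ℕ, Measurable fun h : Finset.Iic n → V =>
      if ∀ k, h k ∈ W then φ (h ⟨n, Finset.mem_Iic.2 le_rfl⟩) else 1 := fun n =>
    measurable_ite_forall_mem (p := fun (h : Finset.Iic n → V) k => h k) W
      (fun i => measurable_pi_apply i) (measurable_pi_apply _)
  have hrestr : ∀ n : ℕ, ∫⁻ ω, (if ∀ k : Finset.Iic n, ω k ∈ W then φ (ω n) else 1) ∂(chainLaw G x) =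
      ∫⁻ h, (if ∀ k, h k ∈ W then φ (h ⟨n, Finset.mem_Iic.2 le_rfl⟩) else 1)
        ∂(Kernel.partialTraj (X := fun _ : ℕ => V) (fun n => historyKernel G n) 0 n
          (fun _ => x)) := by
    intro n
    rw [← Kernel.traj_map_frestrictLe_apply, lintegral_map (hmeas n) (by fun_prop)]
    rfl
  induction n with
  | zero =>
    rw [hrestr, Kernel.partialTraj_self, Kernel.id_apply, lintegral_dirac' _ (hmeas 0)]
    split_ifs with h
    · exact le_rfl
    · push Not at h
      obtain ⟨k, hk⟩ := h
      exact hW x hk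
  | succ n ih =>
    refine le_trans ?_ ih
    have hg : Measurable fun p : (Finset.Iic n → V) × V =>
        if ∀ k, p.1 k ∈ W then φ p.2 else 1 :=
      measurable_ite_forall_mem (p := fun (p : (Finset.Iic n → V) × V) k => p.1 k) W
        (fun i => (measurable_pi_apply i).comp measurable_fst)
        measurable_snd
    calc ∫⁻ ω, (if ∀ k : Finset.Iic (n + 1), ω k ∈ W then φ (ω (n + 1)) else 1) ∂(chainLaw G x)
        ≤ ∫⁻ ω, (if ∀ k : Finset.Iic n, ω k ∈ W then φ (ω (n + 1)) else 1) ∂(chainLaw G x) := by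
          -- If the chain first leaves `W` at time $n+1$, the payoff `1` is at most `φ` there; what
          -- remains is one Markov step from time $n$.
          refine lintegral_mono fun ω => ?_
          dsimp only
          split_ifs with h1 h2 h2
          · exact le_rfl
          · exact absurd (fun k : Finset.Iic n =>
              h1 ⟨k, Finset.mem_Iic.2 ((Finset.mem_Iic.1 k.2).trans n.le_succ)⟩) h2
          · refine hW _ fun h3 => h1 fun k => ?_
            rcases (Finset.mem_Iic.1 k.2).eq_or_lt with h | h
            · rw [h]; exact h3
            · exact h2 ⟨k, Finset.mem_Iic.2 (Nat.lt_succ_iff.1 h)⟩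
          · exact le_rfl
      _ = ∫⁻ p, (if ∀ k, p.1 k ∈ W then φ p.2 else 1)
            ∂((chainLaw G x).map fun ω => (Preorder.frestrictLe n ω, ω (n + 1))) := by
          rw [lintegral_map hg (by fun_prop)]
          rfl
      _ = ∫⁻ h, ∫⁻ y, (if ∀ k, h k ∈ W then φ y else 1) ∂(historyKernel G n h)
            ∂(Kernel.partialTraj (X := fun _ : ℕ => V) (fun n => historyKernel G n) 0 n
              (fun _ => x)) := by
          rw [chainLaw, ← Kernel.partialTraj_compProd_eq_map_traj (Nat.zero_le n),
            Measure.lintegral_compProd hg]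
      _ ≤ _ := by
          rw [hrestr]
          refine lintegral_mono fun h => ?_
          dsimp only
          split_ifs with h1
          · exact hφ _
          · simp

/-- A bounded superharmonic function that is at least `1` off `W` bounds the probability
that the chain leaves `W`. -/
lemma chainLaw_stay_pos {W : Set V} {φ : V → ℝ≥0∞}
    (hφ : ∀ x, ∫⁻ y, φ y ∂(jumpKernel G x) ≤ φ x) (hW : ∀ x, x ∉ W → 1 ≤ φ x) {x : V}
    (hx : φ x < 1) : 0 < chainLaw G x {ω | ∀ n, ω n ∈ W} := by
  classical
  have hmeas : ∀ n : ℕ, MeasurableSet {ω : ℕ → V | ∀ k : Finset.Iic n, ω k ∈ W} := fun n => by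
    have : {ω : ℕ → V | ∀ k : Finset.Iic n, ω k ∈ W} =
        ⋂ k : Finset.Iic n, (fun ω : ℕ → V => ω k) ⁻¹' W := by ext; simp
    rw [this]
    exact MeasurableSet.iInter fun k => measurable_pi_apply (k : ℕ) .of_discrete
  have hleave : ∀ n : ℕ, chainLaw G x {ω : ℕ → V | ∀ k : Finset.Iic n, ω k ∈ W}ᶜ ≤ φ x := fun n => by
    refine le_trans ?_ (lintegral_stopped_le hφ hW x n)
    rw [← lintegral_indicator_one (hmeas n).compl]
    refine lintegral_mono fun ω => ?_
    dsimp only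
    split_ifs with h
    · rw [Set.indicator_of_notMem (by simpa using h)]; exact zero_le
    · exact Set.indicator_le_self' (fun _ _ => zero_le) ω
  have hunion : {ω : ℕ → V | ∀ n, ω n ∈ W}ᶜ = ⋃ n : ℕ, {ω : ℕ → V | ∀ k : Finset.Iic n, ω k ∈ W}ᶜ := by
    ext ω
    simp only [Set.mem_compl_iff, Set.mem_ofPred_eq, Set.mem_iUnion, not_forall]
    exact ⟨fun ⟨n, hn⟩ => ⟨n, ⟨n, Finset.mem_Iic.2 le_rfl⟩, hn⟩, fun ⟨_, k, hk⟩ => ⟨k, hk⟩⟩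
  have hmono : Monotone fun n : ℕ => {ω : ℕ → V | ∀ k : Finset.Iic n, ω k ∈ W}ᶜ := by
    intro m n hmn
    refine Set.compl_subset_compl.2 fun ω h k => ?_
    exact h ⟨k, Finset.mem_Iic.2 ((Finset.mem_Iic.1 k.2).trans hmn)⟩
  have hcompl : chainLaw G x {ω | ∀ n, ω n ∈ W}ᶜ < 1 := by
    rw [hunion, hmono.measure_iUnion]
    exact (iSup_le hleave).trans_lt hx
  rw [pos_iff_ne_zero]
  intro h0
  have := measure_union_le (μ := chainLaw G x) {ω | ∀ n, ω n ∈ W} {ω | ∀ n, ω n ∈ W}ᶜ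
  rw [Set.union_compl_self, measure_univ, h0, zero_add] at this
  exact absurd hcompl (not_lt.2 this)

/-- The position is always some vertex of the embedded chain, whatever the holding times, even where
`sInf` takes its default value on the empty set. -/
lemma walkLaw_stay_pos {W : Set V} {x : V} (h : 0 < chainLaw G x {ω | ∀ n, ω n ∈ W}) :
    0 < walkLaw G x {ω | ∀ t : ℝ≥0, position ω t ∈ W} := by
  have : IsProbabilityMeasure (expMeasure 1) := isProbabilityMeasure_expMeasure one_pos
  refine lt_of_lt_of_le ?_ (measure_mono
    (s := {ω : ℕ → V | ∀ n, ω n ∈ W} ×ˢ (Set.univ : Set (ℕ → ℝ))) ?_)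
  · rw [walkLaw, Measure.prod_prod, measure_univ, mul_one]
    exact h
  · exact fun ω hω t => hω.1 _

lemma lintegral_jumpKernel {x : V} (hx : G.degree x ≠ 0) (φ : V → ℝ≥0∞) :
    ∫⁻ y, φ y ∂(jumpKernel G x) = (G.degree x : ℝ≥0∞)⁻¹ * ∑ y ∈ G.neighborFinset x, φ y := by
  classical
  have hne : (G.neighborFinset x).Nonempty := by
    rw [← Finset.card_pos, G.card_neighborFinset_eq_degree]; exact Nat.pos_of_ne_zero hx
  have hp : jumpPMF G x = PMF.uniformOfFinset (G.neighborFinset x) hne := by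
    rw [jumpPMF, dif_pos hne]
  have hsum : (jumpPMF G x).toMeasure =
      (G.degree x : ℝ≥0∞)⁻¹ • ∑ y ∈ G.neighborFinset x, Measure.dirac y := by
    ext S hS
    rw [hp, PMF.toMeasure_uniformOfFinset_apply hne S hS]
    simp [Measure.dirac_apply' _ hS, Set.indicator_apply, Finset.sum_boole, ENNReal.div_eq_inv_mul]
  change ∫⁻ y, φ y ∂(jumpPMF G x).toMeasure = _
  rw [hsum, lintegral_smul_measure, lintegral_finsetSum_measure]
  simp

lemma lintegral_jumpKernel_of_degree_eq_zero {x : V} (hx : G.degree x = 0) (φ : V → ℝ≥0∞) :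
    ∫⁻ y, φ y ∂(jumpKernel G x) = φ x := by
  have hne : ¬ (G.neighborFinset x).Nonempty := by
    rw [← Finset.card_pos, G.card_neighborFinset_eq_degree, hx]; exact lt_irrefl 0
  change ∫⁻ y, φ y ∂(jumpPMF G x).toMeasure = _
  rw [jumpPMF, dif_neg hne, PMF.toMeasure_pure]
  simp

end ChainEscape

/-! ### Independent signed motion of finitely many particles -/

section CoordinateMeans

variable {V : Type*} (G : SimpleGraph V) [G.LocallyFinite] {ι : Type*} [DecidableEq ι]

/-- Replace the `i`-th of finitely many particles by a uniformly chosen neighbour, with weight `a`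
on the edges. -/
noncomputable def coordMean (a : V → V → ℝ) (i : ι) :
    ((ι → V) → ℝ) →L[ℝ] ((ι → V) → ℝ) where
  toFun f x := (G.degree (x i) : ℝ)⁻¹ *
    ∑ y ∈ G.neighborFinset (x i), a (x i) y * f (Function.update x i y)
  map_add' f g := by
    funext x; simp [mul_add, Finset.sum_add_distrib]
  map_smul' r f := by
    funext x
    simp only [Pi.smul_apply, smul_eq_mul, RingHom.id_apply, Finset.mul_sum]
    exact Finset.sum_congr rfl fun y _ => by ring
  cont := by fun_prop

lemma coordMean_apply (a : V → V → ℝ) (i : ι) (f : (ι → V) → ℝ) (x : ι → V) :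
    coordMean G a i f x = (G.degree (x i) : ℝ)⁻¹ *
      ∑ y ∈ G.neighborFinset (x i), a (x i) y * f (Function.update x i y) := rfl

lemma coordMean_apply_of_eq (a : V → V → ℝ) {i : ι} (f : (ι → V) → ℝ) {x : ι → V} {v : V}
    (hv : x i = v) :
    coordMean G a i f x = (G.degree v : ℝ)⁻¹ *
      ∑ y ∈ G.neighborFinset v, a v y * f (Function.update x i y) := by
  subst hv; rfl

lemma commute_coordMean (a : V → V → ℝ) (i j : ι) :
    Commute (coordMean G a i) (coordMean G a j) := by
  rcases eq_or_ne i j with rfl | hij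
  · exact Commute.refl _
  · refine ContinuousLinearMap.ext fun f => funext fun x => ?_
    have h1 := fun y => coordMean_apply_of_eq G a f (Function.update_of_ne hij.symm y x)
    have h2 := fun y => coordMean_apply_of_eq G a f (Function.update_of_ne hij y x)
    rw [mul_apply_eq_comp, mul_apply_eq_comp, coordMean_apply, coordMean_apply]
    simp_rw [h1, h2, Finset.mul_sum]
    rw [Finset.sum_comm]
    refine Finset.sum_congr rfl fun y _ => Finset.sum_congr rfl fun z _ => ?_
    rw [Function.update_comm hij]
    ring

lemma monotone_coordMean_one (i : ι) : Monotone (coordMean G (fun _ _ => 1) i) := by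
  intro f g hfg x
  simp only [coordMean_apply, one_mul]
  gcongr
  exact hfg _

variable {G}

lemma coordMean_one_const (h0 : ∀ x, G.degree x ≠ 0) (i : ι) (c : ℝ) :
    coordMean G (fun _ _ => 1) i (fun _ => c) = fun _ => c := by
  funext x
  have : (G.degree (x i) : ℝ) ≠ 0 := Nat.cast_ne_zero.2 (h0 _)
  simp [coordMean_apply]
  field_simp

lemma abs_coordMean_le {a : V → V → ℝ} (ha : ∀ x y, G.Adj x y → |a x y| = 1) (i : ι)
    (f : (ι → V) → ℝ) (x : ι → V) :
    |coordMean G a i f x| ≤ coordMean G (fun _ _ => 1) i (fun z => |f z|) x := by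
  rw [coordMean_apply, coordMean_apply, abs_mul, abs_of_nonneg (by positivity)]
  gcongr
  refine (Finset.abs_sum_le_sum_abs _ _).trans (Finset.sum_le_sum fun y hy => ?_)
  rw [abs_mul, ha _ _ ((G.mem_neighborFinset _ _).1 hy)]

variable [Fintype ι]

variable (G ι) in
/-- The mean of the coordinate means: a uniformly chosen particle moves. -/
noncomputable def particleMean (a : V → V → ℝ) : ((ι → V) → ℝ) →L[ℝ] ((ι → V) → ℝ) :=
  (Fintype.card ι : ℝ)⁻¹ • ∑ i, coordMean G a i

lemma particleMean_apply (a : V → V → ℝ) (f : (ι → V) → ℝ) (x : ι → V) :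
    particleMean G ι a f x = (Fintype.card ι : ℝ)⁻¹ * ∑ i, coordMean G a i f x := by
  simp [particleMean]

/-- A bounded function of finitely many particles that is invariant for the signed motion off its
zero set yields a bounded function invariant under the signed motion of each particle. -/
lemma exists_coordMean_fixed [Nonempty ι] (h0 : ∀ x, G.degree x ≠ 0) {a : V → V → ℝ}
    (ha : ∀ x y, G.Adj x y → |a x y| = 1) {U : (ι → V) → ℝ} {b : ℝ} (hb : ∀ x, |U x| ≤ b)
    {x₀ : ι → V} (hx₀ : U x₀ ≠ 0) (hfix : ∀ x, particleMean G ι a U x = U x ∨ U x = 0) :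
    ∃ h : (ι → V) → ℝ, (∃ c, ∀ x, |h x| ≤ c) ∧ (∃ x, h x ≠ 0) ∧ ∀ i, coordMean G a i h = h := by
  have hcard : (Fintype.card ι : ℝ) ≠ 0 := Nat.cast_ne_zero.2 Fintype.card_ne_zero
  have hmono : Monotone (particleMean G ι fun _ _ => 1) := by
    intro f g hfg x
    rw [particleMean_apply, particleMean_apply]
    gcongr with i
    exact monotone_coordMean_one G i hfg x
  have hconst : ∀ c : ℝ, particleMean G ι (fun _ _ => 1) (fun _ => c) = fun _ => c := by
    intro c
    funext x
    rw [particleMean_apply]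
    simp [coordMean_one_const h0, hcard]
  have hdom : ∀ f x, |particleMean G ι a f x| ≤
      particleMean G ι (fun _ _ => 1) (fun z => |f z|) x := by
    intro f x
    rw [particleMean_apply, particleMean_apply, abs_mul, abs_of_nonneg (by positivity)]
    gcongr
    exact (Finset.abs_sum_le_sum_abs _ _).trans (Finset.sum_le_sum fun i _ =>
      abs_coordMean_le ha i f x)
  have hbdd : BddAbove (Set.range fun x => |U x|) := ⟨b, by rintro _ ⟨x, rfl⟩; exact hb x⟩
  have hne : Nonempty (ι → V) := ⟨x₀⟩
  set c : ℝ := ⨆ x, |U x| with hc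
  have hUc : ∀ x, |U x| ≤ c := fun x => le_ciSup hbdd x
  have hcpos : 0 < c := (abs_pos.2 hx₀).trans_le (hUc x₀)
  obtain ⟨h, hhc, hhU, hT⟩ := exists_fixed_point_near (.of_dominated hmono hconst hdom) hUc
    (abs_pow_sub_le_of_dominated hmono hconst hdom hUc hfix)
  -- Where $|U|>c/2$, the bound $|h-U|\le c-|U|<|U|$ excludes $h=0$.
  obtain ⟨x, hx⟩ := exists_lt_of_lt_ciSup (half_lt_self hcpos)
  refine ⟨h, ⟨c, hhc⟩, ⟨x, fun hhx => ?_⟩, fun i => ?_⟩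
  · have := hhU x
    rw [hhx, zero_sub, abs_neg] at this
    linarith
  · refine eq_of_sum_eq_card_smul (fun j => .of_dominated (monotone_coordMean_one G j)
      (coordMean_one_const h0 j) (abs_coordMean_le ha j)) (commute_coordMean G a) hhc ?_ i
    rw [← smul_right_injective _ (inv_ne_zero hcard) |>.eq_iff, inv_smul_smul₀ hcard]
    nth_rw 2 [← hT]
    simp [particleMean]

end CoordinateMeans

/-! ### From annihilating particles to a single signed walk -/

section HarmonicFunction

variable {V : Type*} {G : SimpleGraph V} [G.LocallyFinite]

lemma image_update_eq_symmDiff [DecidableEq V] {ι : Type*} [Fintype ι] [DecidableEq ι]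
    {x : ι → V} (hx : Function.Injective x) {i : ι} {y : V} (hy : y ∉ Set.range x) :
    Finset.univ.image (Function.update x i y) =
      symmDiff (symmDiff (Finset.univ.image x) {x i}) {y} := by
  ext z
  simp only [Finset.mem_image, Finset.mem_univ, true_and, Finset.mem_symmDiff,
    Finset.mem_singleton]
  constructor
  · rintro ⟨j, rfl⟩
    rcases eq_or_ne j i with rfl | hj
    · rw [Function.update_self]
      refine .inr ⟨rfl, ?_⟩
      rintro (h | h)
      · exact hy h.1
      · exact h.2 ⟨_, h.1.symm⟩
    · rw [Function.update_of_ne hj]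
      exact .inl ⟨.inl ⟨⟨j, rfl⟩, hx.ne hj⟩, fun h => hy ⟨j, h⟩⟩
  · rintro (⟨⟨⟨j, rfl⟩, hj⟩ | ⟨rfl, hj⟩, -⟩ | ⟨rfl, -⟩)
    · exact ⟨j, Function.update_of_ne (fun h => hj (congrArg x h)) _ _⟩
    · exact absurd ⟨i, rfl⟩ hj
    · exact ⟨i, Function.update_self ..⟩

lemma injective_update {ι : Type*} [DecidableEq ι] {x : ι → V} (hx : Function.Injective x)
    {i : ι} {y : V} (hy : y ∉ Set.range x) : Function.Injective (Function.update x i y) := by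
  intro j k hjk
  by_cases hj : j = i <;> by_cases hk : k = i
  · rw [hj, hk]
  · subst hj
    rw [Function.update_self, Function.update_of_ne hk] at hjk
    exact absurd ⟨k, hjk.symm⟩ hy
  · subst hk
    rw [Function.update_self, Function.update_of_ne hj] at hjk
    exact absurd ⟨j, hjk⟩ hy
  · rw [Function.update_of_ne hj, Function.update_of_ne hk] at hjk
    exact hx hjk

/-- This is the annihilation: a particle jumping onto another removes both. -/
lemma card_symmDiff_pair_lt [DecidableEq V] {B : Finset V} {u v : V} (hu : u ∈ B) (hv : v ∈ B)
    (huv : v ≠ u) : (symmDiff (symmDiff B {u}) {v}).card < B.card := by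
  refine Finset.card_lt_card (Finset.ssubset_iff_of_subset (fun z hz => ?_) |>.2 ⟨u, hu, ?_⟩)
  · simp only [Finset.mem_symmDiff, Finset.mem_singleton] at hz
    rcases hz with ⟨⟨h, -⟩ | ⟨rfl, -⟩, -⟩ | ⟨rfl, -⟩ <;> assumption
  · simp only [Finset.mem_symmDiff, Finset.mem_singleton]
    tauto

open Classical in
/-- A nonzero bounded function that is harmonic for signed annihilating random walks and vanishes
at the empty set yields a nonzero bounded function harmonic for a single signed random walk. -/
lemma exists_signed_harmonic (h0 : ∀ x, G.degree x ≠ 0) {a : V → V → ℝ}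
    (ha : ∀ x y, G.Adj x y → |a x y| = 1) {w : Finset V → ℝ} {b : ℝ} (hb : ∀ A, |w A| ≤ b)
    (hempty : w ∅ = 0)
    (hw : ∀ A, ∑ x ∈ A, (G.degree x : ℝ)⁻¹ * ∑ y ∈ G.neighborFinset x,
      (a x y * w (symmDiff (symmDiff A {x}) {y}) - w A) = 0)
    (hne : ∃ A, w A ≠ 0) :
    ∃ h : V → ℝ, (∃ c, ∀ x, |h x| ≤ c) ∧ (∃ x, h x ≠ 0) ∧
      ∀ x, (G.degree x : ℝ)⁻¹ * ∑ y ∈ G.neighborFinset x, a x y * h y = h x := by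
  obtain ⟨A, hA, hmin⟩ :=
    WellFounded.has_min (measure (Finset.card (α := V))).wf {A | w A ≠ 0} hne
  replace hmin : ∀ B : Finset V, B.card < A.card → w B = 0 := fun B hB => by
    by_contra h
    exact hmin B h hB
  have hAne : A.Nonempty := Finset.nonempty_iff_ne_empty.2 fun h => hA (h ▸ hempty)
  have : Nonempty A := hAne.to_subtype
  let U : (A → V) → ℝ := fun x => if Function.Injective x then w (Finset.univ.image x) else 0
  have hUb : ∀ x, |U x| ≤ b := fun x => by
    dsimp only [U]
    split_ifs
    · exact hb _
    · rw [abs_zero]; exact (abs_nonneg _).trans (hb ∅)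
  have hU₀ : U Subtype.val ≠ 0 := by
    have : Finset.univ.image (Subtype.val : A → V) = A := by
      ext z; simp
    dsimp only [U]
    rw [if_pos Subtype.val_injective, this]
    exact hA
  have hfix : ∀ x, particleMean G A a U x = U x ∨ U x = 0 := by
    intro x
    by_cases hx : Function.Injective x
    · left
      set B : Finset V := Finset.univ.image x with hB
      have hBcard : B.card = A.card := by
        rw [hB, Finset.card_image_of_injective _ hx, Finset.card_univ, Fintype.card_coe]
      have hUx : U x = w B := if_pos hx
      have hstep : ∀ i, ∀ y ∈ G.neighborFinset (x i),
          U (Function.update x i y) = w (symmDiff (symmDiff B {x i}) {y}) := by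
        intro i y hy
        have hyi : y ≠ x i := ((G.mem_neighborFinset _ _).1 hy).ne'
        by_cases hyr : y ∈ Set.range x
        · obtain ⟨j, rfl⟩ := hyr
          have hji : j ≠ i := fun h => hyi (h ▸ rfl)
          -- At a collision both sides vanish: `w` by minimality of `A`, and `U` by definition.
          rw [hmin _ ((card_symmDiff_pair_lt (by simp [hB]) (by simp [hB]) hyi).trans_eq hBcard)]
          refine if_neg fun hinj => hji (hinj ?_)
          rw [Function.update_self, Function.update_of_ne hji]
        · rw [hB, ← image_update_eq_symmDiff hx hyr]
          exact if_pos (injective_update hx hyr)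
      have hsum : ∑ i, coordMean G a i U x = (A.card : ℝ) * w B := by
        have h1 := hw B
        rw [hB, Finset.sum_image hx.injOn, ← hB] at h1
        have h2 : ∀ i : A, coordMean G a i U x = (G.degree (x i) : ℝ)⁻¹ *
            ∑ y ∈ G.neighborFinset (x i),
              (a (x i) y * w (symmDiff (symmDiff B {x i}) {y}) - w B) + w B := by
          intro i
          have hd : (G.degree (x i) : ℝ) ≠ 0 := Nat.cast_ne_zero.2 (h0 _)
          rw [coordMean_apply, Finset.sum_congr rfl fun y hy => by rw [hstep i y hy],
            Finset.sum_sub_distrib, Finset.sum_const, G.card_neighborFinset_eq_degree,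
            nsmul_eq_mul, mul_sub, inv_mul_cancel_left₀ hd, sub_add_cancel]
        rw [Finset.sum_congr rfl fun i _ => h2 i, Finset.sum_add_distrib, h1]
        simp
      have hcard : (A.card : ℝ) ≠ 0 := Nat.cast_ne_zero.2 hAne.card_pos.ne'
      rw [particleMean_apply, hsum, hUx, Fintype.card_coe, inv_mul_cancel_left₀ hcard]
    · exact .inr (if_neg hx)
  obtain ⟨h, ⟨c, hc⟩, ⟨x, hx⟩, hh⟩ := exists_coordMean_fixed h0 ha hUb hU₀ hfix
  obtain ⟨i⟩ := this
  refine ⟨fun v => h (Function.update x i v), ⟨c, fun v => hc _⟩, ⟨x i, by simpa using hx⟩,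
    fun v => ?_⟩
  have := congrFun (hh i) (Function.update x i v)
  rw [coordMean_apply_of_eq G a h (Function.update_self i v x)] at this
  simpa using this

end HarmonicFunction

/-! ### The region where a signed harmonic function is nearly maximal -/

section SatisfiedRegion

variable {V : Type*} {G : SimpleGraph V}

/-- There are no unsatisfied cycles where all edges are satisfied in some gauge. -/
lemma hasNoUnsatisfiedCycle_of_gauge {s : G.edgeSet → ℤˣ} {W : Set V} (g : V → ℤˣ)
    (hg : ∀ (x y : V) (h : G.Adj x y), x ∈ W → y ∈ W → s ⟨s(x, y), h⟩ = g x * g y) :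
    HasNoUnsatisfiedCycle s W := by
  have key : ∀ {u v : V} (p : G.Walk u v), (∀ z ∈ p.support, z ∈ W) →
      walkSign s p = g u * g v := by
    intro u v p
    induction p with
    | nil => intro _; rw [walkSign, Int.units_mul_self]
    | cons h p ih =>
      intro hp
      rw [SimpleGraph.Walk.support_cons] at hp
      rw [walkSign, ih fun z hz => hp z (List.mem_cons_of_mem _ hz),
        hg _ _ h (hp _ List.mem_cons_self) (hp _ (List.mem_cons_of_mem _ p.start_mem_support)),
        mul_assoc, ← mul_assoc (g _) (g _) (g _), Int.units_mul_self, one_mul]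
  intro v p hp
  rw [key p hp, Int.units_mul_self]
  decide

variable [G.LocallyFinite]

/-- An edge between two points at which a signed harmonic function is nearly maximal in absolute
value is satisfied in the gauge given by its sign. -/
lemma edge_mul_pos_of_signed_harmonic {a : V → V → ℝ} (ha : ∀ x y, G.Adj x y → |a x y| = 1)
    {h : V → ℝ} {c : ℝ} (hc : ∀ x, |h x| ≤ c)
    (hh : ∀ x, (G.degree x : ℝ)⁻¹ * ∑ y ∈ G.neighborFinset x, a x y * h y = h x)
    {M : ℕ} (hM : ∀ x, G.degree x ≤ M) {x y : V} (hxy : G.Adj x y)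
    (hx : c - c / M < |h x|) : 0 < a x y * h x * h y := by
  classical
  by_contra! hneg
  have hc0 : 0 ≤ c := (abs_nonneg _).trans (hc x)
  have hmem : y ∈ G.neighborFinset x := (G.mem_neighborFinset x y).2 hxy
  have hdpos : 0 < G.degree x := by
    rw [← G.card_neighborFinset_eq_degree]; exact Finset.card_pos.2 ⟨y, hmem⟩
  have hd : (0 : ℝ) < G.degree x := Nat.cast_pos.2 hdpos
  have hdM : (G.degree x : ℝ) ≤ M := Nat.cast_le.2 (hM x)
  obtain ⟨t, ht, htx⟩ : ∃ t : ℝ, |t| = 1 ∧ t * h x = |h x| := by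
    rcases abs_cases (h x) with ⟨h1, -⟩ | ⟨h1, -⟩
    · exact ⟨1, by simp, by rw [h1, one_mul]⟩
    · exact ⟨-1, by simp, by rw [h1]; ring⟩
  have htt : t * t = 1 := by rw [← abs_mul_abs_self, ht, one_mul]
  have hxpos : 0 < |h x| := by
    have : c / M ≤ c := div_le_self hc0 (by exact_mod_cast hdpos.trans_le (hM x))
    linarith
  have hyneg : t * (a x y * h y) ≤ 0 := by
    by_contra! hpos
    have h1 : h x = t * |h x| := by rw [← htx, ← mul_assoc, htt, one_mul]
    have h2 : a x y * h x * h y = |h x| * (t * (a x y * h y)) := by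
      calc a x y * h x * h y = a x y * (t * |h x|) * h y := by rw [← h1]
        _ = _ := by ring
    have := mul_pos hxpos hpos
    linarith
  -- The term at `y` is at most zero and the others are at most $c$, whence $|h(x)|\le c-c/d(x)\le
  -- c-c/M$.
  have hsum : ∑ z ∈ G.neighborFinset x, t * (a x z * h z) ≤ ((G.degree x : ℝ) - 1) * c := by
    rw [← Finset.add_sum_erase _ _ hmem]
    have h1 : ∀ z ∈ (G.neighborFinset x).erase y, t * (a x z * h z) ≤ c := fun z hz => by
      refine (le_abs_self _).trans ?_
      rw [abs_mul, abs_mul, ht, ha x z ((G.mem_neighborFinset x z).1 (Finset.mem_of_mem_erase hz)),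
        one_mul, one_mul]
      exact hc z
    have h2 := Finset.sum_le_card_nsmul _ _ _ h1
    rw [Finset.card_erase_of_mem hmem, G.card_neighborFinset_eq_degree, nsmul_eq_mul,
      Nat.cast_sub hdpos, Nat.cast_one] at h2
    linarith
  have hle : |h x| ≤ c - c / M := by
    calc |h x| = (G.degree x : ℝ)⁻¹ * ∑ z ∈ G.neighborFinset x, t * (a x z * h z) := by
          rw [← htx, ← Finset.mul_sum, mul_left_comm, hh x]
      _ ≤ (G.degree x : ℝ)⁻¹ * (((G.degree x : ℝ) - 1) * c) := by gcongr
      _ = c - c / G.degree x := by field_simp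
      _ ≤ c - c / M := by gcongr
  linarith

/-- A nonzero bounded signed harmonic function yields a region without unsatisfied cycles in
which the walk may stay forever. -/
lemma exists_region_of_signed_harmonic [MeasurableSpace V] [DiscreteMeasurableSpace V]
    {s : G.edgeSet → ℤˣ} (h0 : ∀ x, G.degree x ≠ 0) {M : ℕ} (hM : ∀ x, G.degree x ≤ M)
    {h : V → ℝ} {b : ℝ} (hb : ∀ x, |h x| ≤ b) {x₀ : V} (hx₀ : h x₀ ≠ 0)
    (hh : ∀ x, (G.degree x : ℝ)⁻¹ * ∑ y ∈ G.neighborFinset x, edgeSign G s x y * h y = h x) :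
    ∃ W : Set V, HasNoUnsatisfiedCycle s W ∧ ∃ x, 0 < chainLaw G x {ω | ∀ n, ω n ∈ W} := by
  have hbdd : BddAbove (Set.range fun x => |h x|) := ⟨b, by rintro _ ⟨x, rfl⟩; exact hb x⟩
  have : Nonempty V := ⟨x₀⟩
  set c : ℝ := ⨆ x, |h x| with hcdef
  have hc : ∀ x, |h x| ≤ c := fun x => le_ciSup hbdd x
  have hcpos : 0 < c := (abs_pos.2 hx₀).trans_le (hc x₀)
  have hMpos : (0 : ℝ) < M := Nat.cast_pos.2 ((Nat.pos_of_ne_zero (h0 x₀)).trans_le (hM x₀))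
  have ha : ∀ x y, G.Adj x y → |edgeSign G s x y| = 1 := fun x y hxy => abs_edgeSign G s hxy
  obtain ⟨x, hx⟩ := exists_lt_of_lt_ciSup (show c - c / M < ⨆ x, |h x| by
    rw [← hcdef]; linarith [div_pos hcpos hMpos])
  refine ⟨{x | c - c / M < |h x|}, hasNoUnsatisfiedCycle_of_gauge
    (fun x => open Classical in if 0 < h x then 1 else -1) ?_, x, ?_⟩
  · intro x y hxy hxW hyW
    have hpos := edge_mul_pos_of_signed_harmonic ha hc hh hM hxy hxW
    rw [edgeSign, dif_pos hxy] at hpos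
    rcases Int.units_eq_one_or (s ⟨s(x, y), hxy⟩) with hs | hs <;> rw [hs] at hpos ⊢ <;>
      split_ifs with h1 h2 h2 <;> simp only [mul_one, mul_neg, neg_neg] <;>
      simp at hpos <;> nlinarith
  -- Scaled to equal one at the threshold $|h|=c-c/M$ that defines the region.
  · let φ : V → ℝ≥0∞ := fun x => ENNReal.ofReal ((c - |h x|) * (M / c))
    have hφ0 : ∀ x, 0 ≤ (c - |h x|) * (M / c) := fun x =>
      mul_nonneg (sub_nonneg.2 (hc x)) (by positivity)
    refine chainLaw_stay_pos (φ := φ) (fun x => ?_) (fun x hxW => ?_) ?_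
    · have hd : (0 : ℝ) < G.degree x := Nat.cast_pos.2 (Nat.pos_of_ne_zero (h0 x))
      have hsub : |h x| ≤ (G.degree x : ℝ)⁻¹ * ∑ y ∈ G.neighborFinset x, |h y| := by
        rw [← hh x, abs_mul, abs_of_nonneg (inv_nonneg.2 hd.le)]
        gcongr
        refine (Finset.abs_sum_le_sum_abs _ _).trans (Finset.sum_le_sum fun y hy => ?_)
        rw [abs_mul, ha x y ((G.mem_neighborFinset x y).1 hy), one_mul]
      have hcast : (G.degree x : ℝ≥0∞)⁻¹ = ENNReal.ofReal ((G.degree x : ℝ)⁻¹) := by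
        rw [ENNReal.ofReal_inv_of_pos hd, ENNReal.ofReal_natCast]
      rw [lintegral_jumpKernel (h0 x), hcast, ← ENNReal.ofReal_sum_of_nonneg fun y _ => hφ0 y,
        ← ENNReal.ofReal_mul (inv_nonneg.2 hd.le)]
      refine ENNReal.ofReal_le_ofReal ?_
      rw [← Finset.sum_mul, ← mul_assoc]
      gcongr
      rw [Finset.sum_sub_distrib, Finset.sum_const, G.card_neighborFinset_eq_degree, nsmul_eq_mul,
        mul_sub, inv_mul_cancel_left₀ hd.ne']
      linarith
    · have h1 : |h x| ≤ c - c / M := not_lt.1 hxW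
      rw [← ENNReal.ofReal_one]
      refine ENNReal.ofReal_le_ofReal ?_
      calc (1 : ℝ) = c / M * (M / c) := by field_simp
        _ ≤ (c - |h x|) * (M / c) := by gcongr; linarith
    · refine ENNReal.ofReal_lt_one.2 ?_
      calc (c - |h x|) * (M / c) < c / M * (M / c) := by gcongr; linarith
        _ = 1 := by field_simp

/-- The walk started at an isolated vertex stays there. -/
lemma exists_region_of_degree_eq_zero [MeasurableSpace V] [DiscreteMeasurableSpace V]
    (s : G.edgeSet → ℤˣ) {x : V} (hx : G.degree x = 0) :
    ∃ W : Set V, HasNoUnsatisfiedCycle s W ∧ ∃ x, 0 < chainLaw G x {ω | ∀ n, ω n ∈ W} := by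
  refine ⟨{x}, hasNoUnsatisfiedCycle_of_gauge 1 ?_, x,
    chainLaw_stay_pos (φ := Set.indicator {x}ᶜ 1) (fun y => ?_) (fun y hy => ?_) ?_⟩
  · rintro u v huv rfl rfl
    exact absurd rfl huv.ne
  · by_cases hy : y = x
    · rw [hy, lintegral_jumpKernel_of_degree_eq_zero hx]
    · rw [Set.indicator_of_mem (by simpa using hy)]
      calc ∫⁻ z, Set.indicator {x}ᶜ 1 z ∂(jumpKernel G y)
          ≤ ∫⁻ _, 1 ∂(jumpKernel G y) :=
            lintegral_mono fun z => Set.indicator_le_self' (fun _ _ => zero_le) z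
        _ = 1 := by simp
  · rw [Set.indicator_of_mem (by simpa using hy)]; simp
  · simp

end SatisfiedRegion

end SignedVoter

/-! ### The theorem -/

open SignedVoter in
theorem proposition1 {V : Type*} [MeasurableSpace V] [DiscreteMeasurableSpace V]
    (G : SimpleGraph V) [G.LocallyFinite] (s : G.edgeSet → ℤˣ)
    (hdeg : ∃ M : ℕ, ∀ x, G.degree x ≤ M)
    (hmult : HasMultipleEquilibria G s) :
    ∃ W : Set V, HasNoUnsatisfiedCycle s W ∧
      ∃ x : V, 0 < walkLaw G x {ω | ∀ t : ℝ≥0, position ω t ∈ W} := by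
  classical
  suffices h : ∃ W : Set V, HasNoUnsatisfiedCycle s W ∧
      ∃ x, 0 < chainLaw G x {ω | ∀ n, ω n ∈ W} by
    obtain ⟨W, hW, x, hx⟩ := h
    exact ⟨W, hW, x, walkLaw_stay_pos hx⟩
  -- Isolated vertices are treated apart: the averaging operators vanish there, whereas the walk
  -- stays put.
  by_cases h0 : ∀ x, G.degree x ≠ 0
  · obtain ⟨M, hM⟩ := hdeg
    obtain ⟨μ, ν, hμ, hν, hne⟩ := hmult
    have := hμ.1
    have := hν.1
    have hbound : ∀ (ρ : Measure (Config V)) [IsProbabilityMeasure ρ] (A : Finset V),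
        |∫ η, spinProd A η ∂ρ| ≤ 1 := fun ρ _ A => by
      have := norm_integral_le_of_norm_le_const (μ := ρ) (f := spinProd A)
        (ae_of_all _ fun η => (abs_spinProd A η).le)
      simpa using this
    obtain ⟨h, ⟨c, hc⟩, ⟨x, hx⟩, hh⟩ := exists_signed_harmonic h0
      (fun x y hxy => abs_edgeSign G s hxy) (b := 2)
      (w := fun A => ∫ η, spinProd A η ∂μ - ∫ η, spinProd A η ∂ν)
      (fun A => by
        have h1 := abs_le.1 (hbound μ A)
        have h2 := abs_le.1 (hbound ν A)
        rw [abs_le]; constructor <;> linarith)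
      (by simp [spinProd])
      (fun A => by
        have h1 := hμ.sum_integral_spinProd A
        have h2 := hν.sum_integral_spinProd A
        rw [← sub_self (0 : ℝ)]
        nth_rw 1 [← h1]
        rw [← h2, ← Finset.sum_sub_distrib]
        refine Finset.sum_congr rfl fun x _ => ?_
        rw [← mul_sub, ← Finset.sum_sub_distrib]
        congr 1
        exact Finset.sum_congr rfl fun y _ => by ring)
      (by
        by_contra! hall
        exact hne (ext_of_integral_spinProd fun A => sub_eq_zero.1 (hall A)))
    exact exists_region_of_signed_harmonic h0 hM hc hx hh
  · push Not at h0
    obtain ⟨x, hx⟩ := h0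
    exact exists_region_of_degree_eq_zero s hx
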